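/- Let $A$ be a commutative ring with unit. For an integer $n\ge 0$ let $L^n(A)=A((t_1))\ldots((t_n))$ be the $A$-algebra of iterated Laurent series, that is, $L^0(A)=A$ and $L^{n}(A)=L^{n-1}(A)((t_n))$ for $n\ge 1$. Every $f\in L^n(A)$ is written as $f=\sum_{l\in\mathbb Z^n}a_lt^l$, where $a_l\in A$ and $t^l=t_1^{l_1}\cdots t_n^{l_n}$; put $\mathrm{supp}(f)=\{l\in\mathbb Z^n : a_l\neq 0\}$. *Topology.* Let $\Lambda_0$ be a point, $\mathbb Z^0_\lambda=\mathbb Z^0$, and inductively $\Lambda_n=\mathrm{Map}(\mathbb Z,\Lambda_{n-1})\times\mathbb Z$ and, for $\lambda=(\lambda',\lambda_n)\in\Lambda_n$, $\mathbb Z^n_\lambda=\{l\in\mathbb Z^n : l_n\ge\lambda_n,\ (l_1,\ldots,l_{n-1})\in\mathbb Z^{n-1}_{\lambda'(l_n)}\}$. The additive group $L^n(A)$ is given the group topology in which the subgroups $U_\lambda=\{f : \mathrm{supp}(f)\cap(-\mathbb Z^n_\lambda)=\varnothing\}$, $\lambda\in\Lambda_n$, form a base of neighbourhoods of zero. *Valuation.*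 Let $\underline{\mathbb Z}(A)$ be the ring of locally constant functions $\mathrm{Spec}(A)\to\mathbb Z$. Order $\mathbb Z^n$ lexicographically with the last coordinate the most significant. For every unit $f=\sum a_lt^l\in L^n(A)^*$ there is a unique $\nu(f)\in\underline{\mathbb Z}(A)^n$ with the following property: there are a finite decomposition $A\simeq\prod_iB_i$ into a product of rings and elements $l_i\in\mathbb Z^n$ such that, for every $i$, the image of $a_l$ in $B_i$ is nilpotent for all $l<l_i$, the image of $a_{l_i}$ in $B_i$ is invertible, and $\nu(f)$ is equal to $l_i$ on $\mathrm{Spec}(B_i)\subset\mathrm{Spec}(A)$. For a continuous homomorphism of $A$-algebras $\phi\colon L^n(A)\to L^m(A)$, let $$\Upsilon(\phi)=\big(\nu(\phi(t_1)),\ldots,\nu(\phi(t_n))\big)$$ be the $m\times n$-matrix over $\underline{\mathbb Z}(A)$ whose $j$-th column is $\nu(\phi(t_j))$. **Proposition.** (1) For all $n,m\ge 0$, every continuous homomorphism of $A$-algebras $\phi\colon L^n(A)\to L^m(A)$ and every $f\in L^n(A)^*$, there is an equality in $\underline{\mathbb Z}(A)^m$ $$\nu(\phi(f))=\Upsilon(\phi)\cdot\nu(f).$$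 (2) For every $n\ge 0$, the map $\Upsilon$ from the monoid of continuous endomorphisms of the $A$-algebra $L^n(A)$ (under composition) to the multiplicative monoid of $n\times n$-matrices over $\underline{\mathbb Z}(A)$ is a homomorphism of monoids, that is, $\Upsilon(\mathrm{id})$ is the identity matrix and $\Upsilon(\phi\circ\psi)=\Upsilon(\phi)\cdot\Upsilon(\psi)$ for all $\phi,\psi$. (3) If a continuous endomorphism $\phi$ of the $A$-algebra $L^n(A)$ is invertible in this monoid, then the matrix $\Upsilon(\phi)$ is invertible. -/

import Mathlib

universe u

noncomputable section

namespace IterLaurent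

/-! ### Iterated Laurent series -/

/-- The underlying ring of `L^n(A)`: `L^0(A) = A` and `L^(n+1)(A) = L^n(A)((t_(n+1)))`. The type and
its ring structure have to be constructed simultaneously. -/
def bundle (A : Type u) [CommRing A] : ℕ → Σ R : Type u, CommRing R
  | 0 => ⟨A, inferInstance⟩
  | n + 1 =>
    letI : CommRing (bundle A n).1 := (bundle A n).2
    ⟨LaurentSeries (bundle A n).1, inferInstance⟩

end IterLaurent

/-- The ring `L^n(A) = A((t_1))...((t_n))` of iterated Laurent series over `A`. In terms of indices
in `Fin n`, the variable with the last index is the outermost one. -/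
def IterLaurent (A : Type u) [CommRing A] (n : ℕ) : Type u := (IterLaurent.bundle A n).1

namespace IterLaurent

variable {A : Type u} [CommRing A]

instance instCommRing (n : ℕ) : CommRing (IterLaurent A n) := (bundle A n).2

/-- The identification `L^0(A) = A`. -/
def zeroEquiv : IterLaurent A 0 ≃+* A := RingEquiv.refl A

/-- The identification `L^(n+1)(A) = L^n(A)((t_(n+1)))`. -/
def succEquiv (n : ℕ) : IterLaurent A (n + 1) ≃+* LaurentSeries (IterLaurent A n) :=
  RingEquiv.refl (LaurentSeries (IterLaurent A n))

/-- The structure map `A → L^n(A)`, sending an element of `A` to the corresponding constant. -/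
def const : ∀ n : ℕ, A →+* IterLaurent A n
  | 0 => (zeroEquiv (A := A)).symm.toRingHom
  | n + 1 => (succEquiv n).symm.toRingHom.comp (HahnSeries.C.comp (const n))

instance instAlgebra (n : ℕ) : Algebra A (IterLaurent A n) := (const n).toAlgebra

/-- The coefficient `a_l` of `f = ∑ a_l t^l`, where `t^l = t_1^(l_1) ... t_n^(l_n)`. -/
def coeff : ∀ {n : ℕ}, IterLaurent A n → (Fin n → ℤ) → A
  | 0, f, _ => zeroEquiv f
  | n + 1, f, l => coeff ((succEquiv n f).coeff (l (Fin.last n))) (Fin.init l)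

/-- The variables `t_1, ..., t_n`, as invertible elements of `L^n(A)`. -/
def var : ∀ {n : ℕ}, Fin n → (IterLaurent A n)ˣ
  | 0, i => i.elim0
  | n + 1, i =>
    Units.map (succEquiv n).symm.toRingHom.toMonoidHom
      (Fin.lastCases (motive := fun _ => (LaurentSeries (IterLaurent A n))ˣ)
        ⟨HahnSeries.single 1 1, HahnSeries.single (-1) 1, by simp, by simp⟩
        (fun j => Units.map
          (HahnSeries.C : IterLaurent A n →+* LaurentSeries (IterLaurent A n)).toMonoidHom
          (var j)) i)

theorem coeff_succ {n : ℕ} (f : IterLaurent A (n + 1)) (l : Fin (n + 1) → ℤ) :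
    coeff f l = coeff ((succEquiv n f).coeff (l (Fin.last n))) (Fin.init l) := rfl

theorem coeff_zero {n : ℕ} (l : Fin n → ℤ) : coeff (0 : IterLaurent A n) l = 0 := by
  induction n with
  | zero => rfl
  | succ n ih => rw [coeff_succ, map_zero]; exact ih _

theorem coeff_add {n : ℕ} (f g : IterLaurent A n) (l : Fin n → ℤ) :
    coeff (f + g) l = coeff f l + coeff g l := by
  induction n with
  | zero => rfl
  | succ n ih => simp only [coeff_succ, map_add]; exact ih _ _ _

theorem coeff_neg {n : ℕ} (f : IterLaurent A n) (l : Fin n → ℤ) :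
    coeff (-f) l = -coeff f l := by
  have h := coeff_add (-f) f l
  rw [neg_add_cancel, coeff_zero] at h
  exact eq_neg_of_add_eq_zero_left h.symm

/-! ### The topology -/

/-- The index set `Λ_n`, where `Λ_n = Map(ℤ, Λ_(n-1)) × ℤ`. Here `Λ_0` is a point, so that `Λ_1`
is identified with `ℤ`. -/
def Idx : ℕ → Type
  | 0 => Unit
  | n + 1 => (ℤ → Idx n) × ℤ

/-- The subset `ℤ^n_λ` of `ℤ^n`: the set of all `l` with `λ_n ≤ l_n` and
`(l_1, ..., l_(n-1)) ∈ ℤ^(n-1)_(λ'(l_n))`, where `λ = (λ', λ_n)`. -/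
def cone : ∀ {n : ℕ}, Idx n → Set (Fin n → ℤ)
  | 0, _ => Set.univ
  | n + 1, lam =>
    {l | lam.2 ≤ l (Fin.last n) ∧ Fin.init l ∈ cone (lam.1 (l (Fin.last n)))}

/-- The basic neighbourhood of zero `U_λ`: all `f` with `supp(f) ∩ (-ℤ^n_λ) = ∅`. -/
def basicNhd {n : ℕ} (lam : Idx n) : Set (IterLaurent A n) :=
  {f | ∀ l : Fin n → ℤ, -l ∈ cone lam → coeff f l = 0}

theorem exists_idx (n : ℕ) : Nonempty (Idx n) := by
  induction n with
  | zero => exact ⟨()⟩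
  | succ n ih => exact ⟨(fun _ => ih.some, 0)⟩

theorem exists_cone_union {n : ℕ} (lam mu : Idx n) :
    ∃ rho : Idx n, cone lam ∪ cone mu ⊆ cone rho := by
  induction n with
  | zero => exact ⟨lam, fun _ _ => trivial⟩
  | succ n ih =>
    choose r hr using ih
    refine ⟨(fun k => r (lam.1 k) (mu.1 k), min lam.2 mu.2), ?_⟩
    rintro l (⟨h1, h2⟩ | ⟨h1, h2⟩)
    · exact ⟨(min_le_left _ _).trans h1, hr _ _ (Or.inl h2)⟩
    · exact ⟨(min_le_right _ _).trans h1, hr _ _ (Or.inr h2)⟩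

/-- The subsets `U_λ` form a base of neighbourhoods of zero of a group topology. -/
@[reducible] def filterBasis (A : Type u) [CommRing A] (n : ℕ) : AddGroupFilterBasis (IterLaurent A n) :=
  addGroupFilterBasisOfComm (Set.range fun lam : Idx n => basicNhd lam)
    (haveI := exists_idx n; Set.range_nonempty _)
    (by
      rintro _ _ ⟨lam, rfl⟩ ⟨mu, rfl⟩
      obtain ⟨rho, h⟩ := exists_cone_union lam mu
      exact ⟨_, ⟨rho, rfl⟩, fun f hf =>
        ⟨fun l hl => hf l (h (Or.inl hl)), fun l hl => hf l (h (Or.inr hl))⟩⟩)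
    (by
      rintro _ ⟨lam, rfl⟩
      exact fun l _ => coeff_zero l)
    (by
      rintro _ ⟨lam, rfl⟩
      refine ⟨_, ⟨lam, rfl⟩, ?_⟩
      rintro _ ⟨f, hf, g, hg, rfl⟩ l hl
      simp only [coeff_add, hf l hl, hg l hl, add_zero])
    (by
      rintro _ ⟨lam, rfl⟩
      refine ⟨_, ⟨lam, rfl⟩, fun f hf l hl => ?_⟩
      simp only [coeff_neg, hf l hl, neg_zero])

/-- The natural topology on `L^n(A)`, with the base of neighbourhoods of zero `U_λ`, `λ ∈ Λ_n`. -/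
instance instTopologicalSpace (n : ℕ) : TopologicalSpace (IterLaurent A n) :=
  (filterBasis A n).topology

instance instIsTopologicalAddGroup (n : ℕ) : IsTopologicalAddGroup (IterLaurent A n) :=
  (filterBasis A n).isTopologicalAddGroup

/-! ### The valuation -/

/-- The strict lexicographical order on `ℤ^n`, for which the last coordinate is the most
significant: `k < l` if and only if `k_n < l_n`, or `k_n = l_n` and
`(k_1, ..., k_(n-1)) < (l_1, ..., l_(n-1))`. -/
def LexLT : ∀ {n : ℕ}, (Fin n → ℤ) → (Fin n → ℤ) → Prop
  | 0, _, _ => False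
  | n + 1, k, l => k (Fin.last n) < l (Fin.last n) ∨
      (k (Fin.last n) = l (Fin.last n) ∧ LexLT (Fin.init k) (Fin.init l))

/-- `IsVal f v` says that the vector `v` of locally constant `ℤ`-valued functions on `Spec A` is the
value at `f` of the valuation: there are a finite decomposition `σ : A ≃ ∏ B_i` into a product of
rings and elements `l_i ∈ ℤ^n` such that the image in `B_i` of the coefficient `a_l` of `f` is
nilpotent for `l < l_i` and is invertible for `l = l_i`, and the function `v` is equal to `l_i` on
`Spec B_i`. -/
def IsVal {n : ℕ} (f : IterLaurent A n) (v : Fin n → LocallyConstant (PrimeSpectrum A) ℤ) : Prop :=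
  ∃ (ι : Type) (_ : Finite ι) (B : ι → Type u) (_ : ∀ i, CommRing (B i))
    (σ : A ≃+* (∀ i, B i)) (l : ι → Fin n → ℤ), ∀ i,
      (∀ k, LexLT k (l i) → IsNilpotent (σ (coeff f k) i)) ∧
      IsUnit (σ (coeff f (l i)) i) ∧
      ∀ (q : PrimeSpectrum (B i)) (j : Fin n),
        v j (PrimeSpectrum.comap ((Pi.evalRingHom B i).comp (σ : A →+* (∀ i, B i))) q) = l i j

/-- The pointwise version of the above: `l` is the least index for which the coefficient of `f`
does not belong to the prime ideal `p`. -/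
def IsLead (p : PrimeSpectrum A) {n : ℕ} (f : IterLaurent A n) (l : Fin n → ℤ) : Prop :=
  (∀ k, LexLT k l → coeff f k ∈ p.asIdeal) ∧ coeff f l ∉ p.asIdeal

theorem lexLT_trichotomy {n : ℕ} (k l : Fin n → ℤ) : LexLT k l ∨ k = l ∨ LexLT l k := by
  induction n with
  | zero => exact Or.inr (Or.inl (Subsingleton.elim _ _))
  | succ n ih =>
    rcases lt_trichotomy (k (Fin.last n)) (l (Fin.last n)) with h | h | h
    · exact Or.inl (Or.inl h)
    · rcases ih (Fin.init k) (Fin.init l) with h' | h' | h'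
      · exact Or.inl (Or.inr ⟨h, h'⟩)
      · refine Or.inr (Or.inl ?_)
        rw [← Fin.snoc_init_self k, ← Fin.snoc_init_self l, h', h]
      · exact Or.inr (Or.inr (Or.inr ⟨h.symm, h'⟩))
    · exact Or.inr (Or.inr (Or.inl h))

theorem lexLT_asymm {n : ℕ} {k l : Fin n → ℤ} (h : LexLT k l) : ¬ LexLT l k := by
  induction n with
  | zero => exact h.elim
  | succ n ih =>
    rcases h with h | ⟨h, h'⟩ <;> rintro (g | ⟨g, g'⟩)
    · omega
    · omega
    · omega
    · exact ih h' g'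

theorem lexLT_add {n : ℕ} {k l : Fin n → ℤ} (r : Fin n → ℤ) (h : LexLT k l) :
    LexLT (k + r) (l + r) := by
  induction n with
  | zero => exact h.elim
  | succ n ih =>
    rcases h with h | ⟨h, h'⟩
    · exact Or.inl (by simpa using h)
    · exact Or.inr ⟨by simpa using h, ih (Fin.init r) h'⟩

theorem IsLead.unique {p : PrimeSpectrum A} {n : ℕ} {f : IterLaurent A n} {k l : Fin n → ℤ}
    (hk : IsLead p f k) (hl : IsLead p f l) : k = l := by
  rcases lexLT_trichotomy k l with h | h | h
  · exact absurd (hl.1 _ h) hk.2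
  · exact h
  · exact absurd (hk.1 _ h) hl.2

/-- All coefficients of `f` belong to `p`. -/
def InPrime (p : PrimeSpectrum A) {n : ℕ} (f : IterLaurent A n) : Prop :=
  ∀ l, coeff f l ∈ p.asIdeal

theorem inPrime_succ {p : PrimeSpectrum A} {n : ℕ} {f : IterLaurent A (n + 1)} :
    InPrime p f ↔ ∀ k, InPrime p ((succEquiv n f).coeff k) := by
  refine ⟨fun h k l => ?_, fun h l => h _ _⟩
  have := h (Fin.snoc l k)
  rwa [coeff_succ, Fin.snoc_last, Fin.init_snoc] at this

theorem InPrime.add {p : PrimeSpectrum A} {n : ℕ} {f g : IterLaurent A n}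
    (hf : InPrime p f) (hg : InPrime p g) : InPrime p (f + g) := fun l => by
  rw [coeff_add]; exact p.asIdeal.add_mem (hf l) (hg l)

theorem inPrime_sum {p : PrimeSpectrum A} {n : ℕ} {J : Type*} (s : Finset J)
    (f : J → IterLaurent A n) (h : ∀ j ∈ s, InPrime p (f j)) : InPrime p (∑ j ∈ s, f j) :=
  Finset.sum_induction f (InPrime p) (fun _ _ => InPrime.add)
    (fun l => by rw [coeff_zero]; exact p.asIdeal.zero_mem) h

theorem InPrime.mul_left {p : PrimeSpectrum A} {n : ℕ} {f : IterLaurent A n}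
    (hf : InPrime p f) (g : IterLaurent A n) : InPrime p (g * f) := by
  induction n with
  | zero => exact fun l => p.asIdeal.mul_mem_left (zeroEquiv g) (hf l)
  | succ n ih =>
    rw [inPrime_succ] at hf ⊢
    intro k
    rw [map_mul, HahnSeries.coeff_mul]
    exact inPrime_sum _ _ fun ij _ => ih (hf _) _

theorem isLead_succ {p : PrimeSpectrum A} {n : ℕ} {f : IterLaurent A (n + 1)}
    {l : Fin (n + 1) → ℤ} :
    IsLead p f l ↔ (∀ k < l (Fin.last n), InPrime p ((succEquiv n f).coeff k)) ∧
      IsLead p ((succEquiv n f).coeff (l (Fin.last n))) (Fin.init l) := by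
  constructor
  · rintro ⟨h1, h2⟩
    refine ⟨fun k hk m => ?_, fun m hm => ?_, h2⟩
    · have := h1 (Fin.snoc m k) (Or.inl (by simpa using hk))
      rwa [coeff_succ, Fin.snoc_last, Fin.init_snoc] at this
    · have := h1 (Fin.snoc m (l (Fin.last n))) (Or.inr ⟨by simp, by simpa using hm⟩)
      rwa [coeff_succ, Fin.snoc_last, Fin.init_snoc] at this
  · rintro ⟨h1, h2, h3⟩
    refine ⟨?_, h3⟩
    rintro k (hk | ⟨hk, hk'⟩)
    · exact h1 _ hk _
    · rw [coeff_succ, hk]; exact h2 _ hk'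

theorem IsLead.add_inPrime {p : PrimeSpectrum A} {n : ℕ} {f g : IterLaurent A n} {l : Fin n → ℤ}
    (hf : IsLead p f l) (hg : InPrime p g) : IsLead p (f + g) l := by
  refine ⟨fun k hk => ?_, fun h => hf.2 ?_⟩
  · rw [coeff_add]; exact p.asIdeal.add_mem (hf.1 k hk) (hg k)
  · rw [coeff_add] at h; exact (p.asIdeal.add_mem_iff_left (hg l)).1 h

theorem IsLead.mul {p : PrimeSpectrum A} {n : ℕ} {f g : IterLaurent A n} {k l : Fin n → ℤ}
    (hf : IsLead p f k) (hg : IsLead p g l) : IsLead p (f * g) (k + l) := by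
  induction n with
  | zero =>
    refine ⟨fun m hm => hm.elim, fun h => ?_⟩
    exact (p.isPrime.mem_or_mem (x := zeroEquiv f) (y := zeroEquiv g) h).elim hf.2 hg.2
  | succ n ih =>
    rw [isLead_succ] at hf hg ⊢
    obtain ⟨hf1, hf2⟩ := hf
    obtain ⟨hg1, hg2⟩ := hg
    rw [map_mul]
    set F := succEquiv n f
    set G := succEquiv n g
    constructor
    · intro m hm
      rw [HahnSeries.coeff_mul]
      refine inPrime_sum _ _ fun ij hij => ?_
      have hs : ij.1 + ij.2 = m := (Finset.mem_antidiagonal.1 hij).2.2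
      by_cases h : ij.1 < k (Fin.last n)
      · rw [mul_comm]; exact (hf1 _ h).mul_left _
      · refine (hg1 _ ?_).mul_left _
        simp only [Pi.add_apply] at hm
        omega
    · have key : ∃ r, InPrime p r ∧ (F * G).coeff ((k + l) (Fin.last n)) =
          F.coeff (k (Fin.last n)) * G.coeff (l (Fin.last n)) + r := by
        rw [HahnSeries.coeff_mul]
        refine ⟨∑ ij ∈ (Finset.antidiagonal F.isPWO_support G.isPWO_support
          ((k + l) (Fin.last n))).erase (k (Fin.last n), l (Fin.last n)),
          F.coeff ij.1 * G.coeff ij.2, inPrime_sum _ _ fun ij hij => ?_, ?_⟩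
        · obtain ⟨hne, hij⟩ := Finset.mem_erase.1 hij
          have hs : ij.1 + ij.2 = k (Fin.last n) + l (Fin.last n) :=
            (Finset.mem_antidiagonal.1 hij).2.2
          by_cases h : ij.1 < k (Fin.last n)
          · rw [mul_comm]; exact (hf1 _ h).mul_left _
          · refine (hg1 _ ?_).mul_left _
            have : ij.1 ≠ k (Fin.last n) := fun h' => hne (Prod.ext h' (by simp only; omega))
            omega
        · by_cases hm : (k (Fin.last n), l (Fin.last n)) ∈ Finset.antidiagonal F.isPWO_support
            G.isPWO_support ((k + l) (Fin.last n))
          · exact (Finset.add_sum_erase _ (fun ij : ℤ × ℤ => F.coeff ij.1 * G.coeff ij.2) hm).symm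
          · rw [Finset.erase_eq_of_notMem hm]
            have h0 : F.coeff (k (Fin.last n)) * G.coeff (l (Fin.last n)) = 0 := by
              by_contra hc
              exact hm (Finset.mem_antidiagonal.2
                ⟨left_ne_zero_of_mul hc, right_ne_zero_of_mul hc, rfl⟩)
            rw [h0, zero_add]
      obtain ⟨r, hr, he⟩ := key
      rw [he]
      exact (ih hf2 hg2).add_inPrime hr

theorem exists_isLead {p : PrimeSpectrum A} {n : ℕ} {f : IterLaurent A n} (hf : ¬ InPrime p f) :
    ∃ l, IsLead p f l := by
  induction n with
  | zero =>
    simp only [InPrime, not_forall] at hf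
    obtain ⟨l, hl⟩ := hf
    exact ⟨l, fun m hm => hm.elim, hl⟩
  | succ n ih =>
    rw [inPrime_succ, not_forall] at hf
    obtain ⟨m, hm, hmin⟩ := Int.exists_least_of_bdd
      (P := fun k => ¬ InPrime p ((succEquiv n f).coeff k)) (by
        refine ⟨(succEquiv n f).order, fun z hz => ?_⟩
        by_contra hlt
        refine hz fun l => ?_
        rw [HahnSeries.coeff_eq_zero_of_lt_order (not_le.1 hlt), coeff_zero]
        exact p.asIdeal.zero_mem) hf
    obtain ⟨l, hl⟩ := ih hm
    refine ⟨Fin.snoc l m, isLead_succ.2 ⟨fun k hk => ?_, ?_⟩⟩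
    · rw [Fin.snoc_last] at hk
      by_contra h
      exact absurd (hmin k h) (not_le.2 hk)
    · rwa [Fin.snoc_last, Fin.init_snoc]

theorem isLead_one (p : PrimeSpectrum A) (n : ℕ) : IsLead p (1 : IterLaurent A n) 0 := by
  induction n with
  | zero => exact ⟨fun k hk => hk.elim, fun h => p.isPrime.ne_top ((Ideal.eq_top_iff_one _).2 h)⟩
  | succ n ih =>
    rw [isLead_succ, map_one]
    refine ⟨fun k hk l => ?_, ?_⟩
    · rw [HahnSeries.coeff_one, if_neg (by simpa using ne_of_lt hk), coeff_zero]
      exact p.asIdeal.zero_mem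
    · rw [Pi.zero_apply, HahnSeries.coeff_one, if_pos rfl]
      exact ih

theorem exists_isLead_unit (p : PrimeSpectrum A) {n : ℕ} (f : (IterLaurent A n)ˣ) :
    ∃ l, IsLead p (f : IterLaurent A n) l ∧ IsLead p (↑f⁻¹ : IterLaurent A n) (-l) := by
  have h1 : ∀ g : (IterLaurent A n)ˣ, ∃ l, IsLead p (g : IterLaurent A n) l := fun g => by
    refine exists_isLead fun h => (isLead_one p n).2 ?_
    have := h.mul_left (↑g⁻¹ : IterLaurent A n)
    rw [Units.inv_mul] at this
    exact this 0
  obtain ⟨l, hl⟩ := h1 f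
  obtain ⟨k, hk⟩ := h1 f⁻¹
  have h := hl.mul hk
  rw [Units.mul_inv] at h
  have h0 := h.unique (isLead_one p n)
  rw [eq_neg_of_add_eq_zero_right h0] at hk
  exact ⟨l, hl, hk⟩

theorem exists_locallyConstant {n : ℕ} (f : (IterLaurent A n)ˣ) :
    ∃ w : LocallyConstant (PrimeSpectrum A) (Fin n → ℤ),
      ∀ p, IsLead p (f : IterLaurent A n) (w p) := by
  choose w hw hw' using fun p => exists_isLead_unit p f
  refine ⟨⟨w, (IsLocallyConstant.iff_exists_open _).2 fun p => ?_⟩, hw⟩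
  refine ⟨↑(PrimeSpectrum.basicOpen (coeff (f : IterLaurent A n) (w p)) ⊓
    PrimeSpectrum.basicOpen (coeff (↑f⁻¹ : IterLaurent A n) (-w p))),
    TopologicalSpace.Opens.isOpen _, ⟨(hw p).2, (hw' p).2⟩, ?_⟩
  rintro q ⟨hq, hq'⟩
  rcases lexLT_trichotomy (w q) (w p) with h | h | h
  · refine absurd ((hw' q).1 (-w p) ?_) hq'
    have := lexLT_add (-w q - w p) h
    rwa [show w q + (-w q - w p) = -w p by abel, show w p + (-w q - w p) = -w q by abel] at this
  · exact h
  · exact absurd ((hw q).1 _ h) hq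

theorem exists_idempotents {Y : Type} (w : LocallyConstant (PrimeSpectrum A) Y) :
    ∃ (_ : Fintype (Set.range w)) (e : Set.range w → A), CompleteOrthogonalIdempotents e ∧
      ∀ i p, e i ∉ p.asIdeal ↔ w p = i := by
  have hfin : Finite (Set.range w) := w.range_finite
  have := Fintype.ofFinite (Set.range w)
  have h : ∀ i : Set.range w, ∃ e : A, IsIdempotentElem e ∧ ∀ p, e ∉ p.asIdeal ↔ w p = i := by
    intro i
    obtain ⟨e, he, h⟩ := PrimeSpectrum.exists_idempotent_basicOpen_eq_of_isClopen
      (w.isLocallyConstant.isClopen_fiber (i : Y))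
    exact ⟨e, he, fun p => ((Set.ext_iff.1 h) p).symm⟩
  choose e he h using h
  have ho : OrthogonalIdempotents e := by
    refine ⟨he, fun i j hij => ?_⟩
    have hn : IsNilpotent (e i * e j) := by
      rw [nilpotent_iff_mem_prime]
      intro J hJ
      by_contra hc
      have h1 : e i ∉ J := fun h' => hc (J.mul_mem_right _ h')
      have h2 : e j ∉ J := fun h' => hc (J.mul_mem_left _ h')
      exact hij (Subtype.ext (((h i ⟨J, hJ⟩).1 h1).symm.trans ((h j ⟨J, hJ⟩).1 h2)))
    exact ((he i).mul (he j)).eq_zero_of_isNilpotent hn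
  refine ⟨inferInstance, e, ⟨ho, ?_⟩, h⟩
  have hu : IsUnit (∑ i, e i) := by
    by_contra hc
    obtain ⟨M, hM, hs⟩ := exists_max_ideal_of_mem_nonunits hc
    let p : PrimeSpectrum A := ⟨M, hM.isPrime⟩
    obtain ⟨i, hi⟩ : ∃ i : Set.range w, w p = i := ⟨⟨w p, Set.mem_range_self p⟩, rfl⟩
    have hp : e i ∉ M := (h i p).2 hi
    refine hp ?_
    rw [← ho.mul_sum_of_mem (Finset.mem_univ i)]
    exact M.mul_mem_left _ hs
  exact (IsIdempotentElem.iff_eq_one_of_isUnit hu).1 ho.isIdempotentElem_sum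

/-- The valuation is characterized by its values at the points of `Spec A`. -/
theorem isVal_iff_isLead {n : ℕ} (f : IterLaurent A n)
    (v : Fin n → LocallyConstant (PrimeSpectrum A) ℤ) :
    IsVal f v ↔ ∀ p, IsLead p f (fun j => v j p) := by
  constructor
  · rintro ⟨ι, _, B, _, σ, l, h⟩ p
    obtain ⟨⟨i, q⟩, hq⟩ := (PrimeSpectrum.sigmaToPi_bijective B).2
      (PrimeSpectrum.comap (σ.symm : (∀ i, B i) →+* A) p)
    have hp : ∀ a, a ∈ p.asIdeal ↔ σ a i ∈ q.asIdeal := fun a => by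
      have := congrArg (fun r : PrimeSpectrum (∀ i, B i) => σ a ∈ r.asIdeal) hq
      simpa [PrimeSpectrum.sigmaToPi, eq_comm] using this
    obtain ⟨h1, h2, h3⟩ := h i
    have hpq : PrimeSpectrum.comap ((Pi.evalRingHom B i).comp (σ : A →+* (∀ i, B i))) q = p := by
      ext a
      exact (hp a).symm
    have hv : (fun j => v j p) = l i := funext fun j => by rw [← h3 q j, hpq]
    rw [hv]
    refine ⟨fun k hk => (hp _).2 ?_, fun hc => ?_⟩
    · exact nilpotent_iff_mem_prime.1 (h1 k hk) _ q.isPrime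
    · exact q.isPrime.ne_top (Ideal.eq_top_of_isUnit_mem _ ((hp _).1 hc) h2)
  · intro h
    obtain ⟨_, e, he, hw⟩ := exists_idempotents (LocallyConstant.unflip v)
    refine ⟨_, inferInstance, fun i => A ⧸ Ideal.span {1 - e i}, inferInstance,
      RingEquiv.ofBijective _ he.bijective_pi, fun i => i.1, fun i => ?_⟩
    have hq : ∀ q : PrimeSpectrum (A ⧸ Ideal.span {1 - e i}), ∀ j,
        v j (PrimeSpectrum.comap (Ideal.Quotient.mk _) q) = i.1 j := by
      intro q j
      refine congrFun ((hw i (PrimeSpectrum.comap (Ideal.Quotient.mk _) q)).1 fun hc => ?_) j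
      refine q.isPrime.ne_top ((Ideal.eq_top_iff_one _).2 ?_)
      have h1 : Ideal.Quotient.mk (Ideal.span {1 - e i}) (1 - e i) = 0 :=
        Ideal.Quotient.eq_zero_iff_mem.2 (Ideal.subset_span rfl)
      rw [map_sub, map_one, sub_eq_zero] at h1
      rw [h1]
      exact hc
    have hl : ∀ q : PrimeSpectrum (A ⧸ Ideal.span {1 - e i}),
        IsLead (PrimeSpectrum.comap (Ideal.Quotient.mk _) q) f i.1 := fun q => by
      have := h (PrimeSpectrum.comap (Ideal.Quotient.mk _) q)
      rwa [funext (hq q)] at this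
    refine ⟨fun k hk => ?_, ?_, hq⟩
    · exact nilpotent_iff_mem_prime.2 fun J hJ => (hl ⟨J, hJ⟩).1 k hk
    · by_contra hc
      obtain ⟨M, hM, hs⟩ := exists_max_ideal_of_mem_nonunits hc
      exact (hl ⟨M, hM.isPrime⟩).2 hs

theorem existsUnique_isVal {n : ℕ} (f : (IterLaurent A n)ˣ) :
    ∃! v, IsVal (f : IterLaurent A n) v := by
  obtain ⟨w, hw⟩ := exists_locallyConstant f
  refine ⟨fun j => w.map (fun l : Fin n → ℤ => l j), (isVal_iff_isLead _ _).2 hw, fun v hv => ?_⟩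
  replace hv := (isVal_iff_isLead _ _).1 hv
  funext j
  ext p
  exact congrFun ((hv p).unique (hw p)) j

/-- The valuation `ν : L^n(A)ˣ → ℤ(A)^n`, where `ℤ(A)` is the ring of locally constant functions on
`Spec A` with values in `ℤ`. -/
def val {n : ℕ} (f : (IterLaurent A n)ˣ) : Fin n → LocallyConstant (PrimeSpectrum A) ℤ :=
  (existsUnique_isVal f).choose

theorem isVal_val {n : ℕ} (f : (IterLaurent A n)ˣ) : IsVal (f : IterLaurent A n) (val f) :=
  (existsUnique_isVal f).choose_spec.1

/-- The `m × n` matrix `Υ(φ) = (ν(φ(t_1)), ..., ν(φ(t_n)))` of a continuous homomorphism of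
`A`-algebras `φ : L^n(A) → L^m(A)`. -/
def upsilon {n m : ℕ} (φ : IterLaurent A n →A[A] IterLaurent A m) :
    Matrix (Fin m) (Fin n) (LocallyConstant (PrimeSpectrum A) ℤ) :=
  Matrix.of fun i j => val (Units.map (φ : IterLaurent A n →* IterLaurent A m) (var j)) i

end IterLaurent

end

noncomputable section

namespace IterLaurent

variable {A : Type u} [CommRing A]

/-! Everything is checked one prime `p` of `A` at a time: by `isVal_iff_isLead`, `ν(f)` at `p` is
the leading exponent of `f` modulo `p`. Leading exponents add under multiplication and exist for
units, so `l ↦` (leading exponent of `φ(t^l)`) is a group homomorphism `r : ℤ^n → ℤ^m`, whose matrix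
is `Υ(φ)` at `p`. Part (1) then says that `φ` carries leading exponent `l` to `r l`, for arbitrary
series and not only for monomials (`IsLead.map`).

Continuity enters twice. First, `r` is strictly increasing (`lexLT_zero_of_isLead_map_monomial`):
for `l > 0`, every neighbourhood of zero contains some power of `t^l`, whereas if `r l ≤ 0`, one
neighbourhood `U_λ` excludes all powers of `φ(t^l)`. Second, Laurent polynomials are dense, so any
single coefficient of `φ f` is already a coefficient of `φ` of a Laurent polynomial
(`coeff_map_mem`). Once `a_l t^l` is split off from `f`, each remaining term either has its
coefficient in `p` or has exponent `j > l`, and then `r j > r l`; hence nothing modulo `p` reaches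
degree `r l` or below.

Part (2) applies (1) to the units `ψ(t_j)`, and (3) is the fact that monoid homomorphisms preserve
units. -/

theorem coeff_smul {n : ℕ} (a : A) (f : IterLaurent A n) (l : Fin n → ℤ) :
    coeff (a • f) l = a * coeff f l := by
  induction n with
  | zero => rfl
  | succ n ih =>
    have h : succEquiv n (a • f) = HahnSeries.C (const n a) * succEquiv n f := rfl
    rw [coeff_succ, h, HahnSeries.C_mul_eq_smul, HahnSeries.coeff_smul, coeff_succ, ← ih]
    rfl

theorem coeff_sum {n : ℕ} {J : Type*} (s : Finset J) (f : J → IterLaurent A n) (l : Fin n → ℤ) :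
    coeff (∑ j ∈ s, f j) l = ∑ j ∈ s, coeff (f j) l :=
  map_sum (⟨⟨fun f => coeff f l, coeff_zero l⟩, fun f g => coeff_add f g l⟩ :
    IterLaurent A n →+ A) f s

/-! ### Monomials -/

variable (A) in
/-- The monomial `t^l`. -/
def monomial : ∀ {n : ℕ}, (Fin n → ℤ) → IterLaurent A n
  | 0, _ => 1
  | n + 1, l => (succEquiv n).symm (HahnSeries.single (l (Fin.last n)) (monomial (Fin.init l)))

theorem succEquiv_monomial {n : ℕ} (l : Fin (n + 1) → ℤ) :
    succEquiv n (monomial A l) =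
      HahnSeries.single (l (Fin.last n)) (monomial A (Fin.init l)) := rfl

theorem monomial_zero (n : ℕ) : monomial A (0 : Fin n → ℤ) = 1 := by
  induction n with
  | zero => rfl
  | succ n ih =>
    apply (succEquiv n).injective
    rw [succEquiv_monomial, map_one]
    exact congrArg (HahnSeries.single (0 : ℤ)) ih

theorem monomial_add {n : ℕ} (k l : Fin n → ℤ) :
    monomial A (k + l) = monomial A k * monomial A l := by
  induction n with
  | zero => exact (mul_one _).symm
  | succ n ih =>
    apply (succEquiv n).injective
    simp only [map_mul, succEquiv_monomial, HahnSeries.single_mul_single, ← ih]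
    rfl

/-- The monomial `t^l` as a unit. -/
def unitMonomial {n : ℕ} (l : Fin n → ℤ) : (IterLaurent A n)ˣ where
  val := monomial A l
  inv := monomial A (-l)
  val_inv := by rw [← monomial_add, add_neg_cancel, monomial_zero]
  inv_val := by rw [← monomial_add, neg_add_cancel, monomial_zero]

theorem monomial_nsmul {n : ℕ} (i : ℕ) (l : Fin n → ℤ) :
    monomial A (i • l) = monomial A l ^ i := by
  induction i with
  | zero => rw [zero_smul, monomial_zero, pow_zero]
  | succ i ih => rw [succ_nsmul, monomial_add, ih, pow_succ]

theorem coeff_monomial {n : ℕ} (l k : Fin n → ℤ) :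
    coeff (monomial A l) k = if k = l then 1 else 0 := by
  induction n with
  | zero => rw [if_pos (Subsingleton.elim _ _)]; rfl
  | succ n ih =>
    rw [coeff_succ, succEquiv_monomial, HahnSeries.coeff_single]
    by_cases h : k (Fin.last n) = l (Fin.last n)
    · rw [if_pos h, ih]
      refine if_congr ⟨fun h' => ?_, fun h' => h' ▸ rfl⟩ rfl rfl
      rw [← Fin.snoc_init_self k, ← Fin.snoc_init_self l, h', h]
    · rw [if_neg h, coeff_zero, if_neg fun h' => h (congrFun h' _)]

theorem var_eq_monomial {n : ℕ} (i : Fin n) :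
    ((var i : (IterLaurent A n)ˣ) : IterLaurent A n) = monomial A (Pi.single i 1) := by
  induction n with
  | zero => exact i.elim0
  | succ n ih =>
    apply (succEquiv n).injective
    rw [succEquiv_monomial]
    refine Fin.lastCases ?_ (fun j => ?_) i
    · have h : Fin.init (Pi.single (Fin.last n) 1 : Fin (n + 1) → ℤ) = 0 := by
        ext j
        simp [Fin.init, (Fin.castSucc_lt_last j).ne]
      rw [h, monomial_zero, Pi.single_eq_same]
      simp [var]
    · have h : Fin.init (Pi.single j.castSucc 1 : Fin (n + 1) → ℤ) = Pi.single j 1 := by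
        ext k
        simp [Fin.init, Pi.single_apply]
      rw [h, ← ih, Pi.single_eq_of_ne (Fin.castSucc_lt_last j).ne']
      simp [var, HahnSeries.C_apply]

theorem isLead_monomial (p : PrimeSpectrum A) {n : ℕ} (l : Fin n → ℤ) :
    IsLead p (monomial A l) l := by
  refine ⟨fun k hk => ?_, fun h => ?_⟩
  · rw [coeff_monomial, if_neg fun h => lexLT_asymm (h ▸ hk) (h ▸ hk)]
    exact p.asIdeal.zero_mem
  · rw [coeff_monomial, if_pos rfl] at h
    exact p.isPrime.ne_top ((Ideal.eq_top_iff_one _).2 h)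

/-! ### The topology -/

theorem exists_mem_cone {n : ℕ} (l : Fin n → ℤ) : ∃ lam : Idx n, l ∈ cone lam := by
  induction n with
  | zero => exact ⟨(), trivial⟩
  | succ n ih =>
    obtain ⟨lam, h⟩ := ih (Fin.init l)
    exact ⟨(fun _ => lam, l (Fin.last n)), le_rfl, h⟩

/-- A cone may have an arbitrary index in each slice of fixed last coordinate. If `l_n > 0`, the
multiples of `l` lie in distinct slices and are accommodated separately; if `l_n = 0`, they share
one slice and induction applies. -/
theorem exists_nsmul_mem_cone {n : ℕ} {l : Fin n → ℤ} (h : ¬ LexLT l 0) :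
    ∃ lam : Idx n, ∀ i : ℕ, i • l ∈ cone lam := by
  induction n with
  | zero => exact ⟨(), fun _ => trivial⟩
  | succ n ih =>
    have h0 : 0 ≤ l (Fin.last n) := not_lt.1 fun h' => h (Or.inl h')
    rcases h0.eq_or_lt with h0 | h0
    · obtain ⟨lam, hl⟩ := ih (l := Fin.init l) fun h' => h (Or.inr ⟨h0.symm, h'⟩)
      exact ⟨(fun _ => lam, 0), fun i => ⟨by simp [← h0], hl i⟩⟩
    · choose r hr using fun i : ℤ => exists_mem_cone (i • (Fin.init l : Fin n → ℤ))
      refine ⟨(fun j => r (j / l (Fin.last n)), 0), fun i => ⟨?_, ?_⟩⟩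
      · simpa using mul_nonneg (Int.natCast_nonneg i) h0.le
      have hi : (i • l) (Fin.last n) / l (Fin.last n) = i := by
        simp [Int.mul_ediv_cancel _ h0.ne']
      have := hr i
      simp only [hi]
      rw [natCast_zsmul] at this
      exact this

theorem exists_nsmul_notMem_cone {n : ℕ} {l : Fin n → ℤ} (h : LexLT 0 l) (lam : Idx n) :
    ∃ i : ℕ, -(i • l) ∉ cone lam := by
  induction n with
  | zero => exact h.elim
  | succ n ih =>
    rcases h with h | ⟨h, h'⟩
    -- With `i ≥ 1 - λ_n` and `l_n ≥ 1`, the last coordinate `-i * l_n` falls below `λ_n`.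
    · refine ⟨(1 - lam.2).toNat, fun hc => ?_⟩
      have h1 := hc.1
      simp only [Pi.zero_apply, Pi.neg_apply, Pi.smul_apply, smul_eq_mul, ← natCast_zsmul] at h h1
      have h2 := Int.self_le_toNat (1 - lam.2)
      nlinarith
    · obtain ⟨i, hi⟩ := ih h' (lam.1 0)
      refine ⟨i, fun hc => hi ?_⟩
      have h2 := hc.2
      rwa [show (-(i • l)) (Fin.last n) = 0 by simp [← h]] at h2

theorem monomial_mem_basicNhd {n : ℕ} {l : Fin n → ℤ} {lam : Idx n} (h : -l ∉ cone lam) :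
    monomial A l ∈ basicNhd (A := A) lam := fun k hk => by
  rw [coeff_monomial, if_neg]
  rintro rfl
  exact h hk

/-- The last exponent is bounded below by the order of the outer Laurent series and above by `-λ_n`,
which leaves finitely many slices, each finite by induction. -/
theorem finite_support_inter_cone {n : ℕ} (f : IterLaurent A n) (lam : Idx n) :
    {l | coeff f l ≠ 0 ∧ -l ∈ cone lam}.Finite := by
  induction n with
  | zero => exact Set.toFinite _
  | succ n ih =>
    refine ((Set.finite_Icc (succEquiv n f).order (-lam.2)).biUnion fun j _ =>
      (ih ((succEquiv n f).coeff j) (lam.1 (-j))).image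
        fun l : Fin n → ℤ => (Fin.snoc l j : Fin (n + 1) → ℤ)).subset ?_
    rintro l ⟨h1, h2, h3⟩
    simp only [Set.mem_iUnion]
    rw [coeff_succ] at h1
    refine ⟨l (Fin.last n), ⟨?_, le_neg.1 h2⟩, Fin.init l, ⟨h1, h3⟩, Fin.snoc_init_self l⟩
    by_contra h
    rw [HahnSeries.coeff_eq_zero_of_lt_order (not_le.1 h), coeff_zero] at h1
    exact h1 rfl

/-- Laurent polynomials are dense. -/
theorem exists_sub_sum_mem_basicNhd {n : ℕ} (f : IterLaurent A n) (lam : Idx n) :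
    ∃ s : Finset (Fin n → ℤ), f - ∑ l ∈ s, coeff f l • monomial A l ∈ basicNhd (A := A) lam := by
  -- These are exactly the exponents of `f` that obstruct membership in `U_λ`.
  refine ⟨(finite_support_inter_cone f lam).toFinset, fun k hk => ?_⟩
  rw [sub_eq_add_neg, coeff_add, coeff_neg, coeff_sum]
  simp only [coeff_smul, coeff_monomial, mul_ite, mul_one, mul_zero, Finset.sum_ite_eq]
  split_ifs with h
  · exact add_neg_cancel _
  · by_contra hc
    exact h ((Set.Finite.mem_toFinset _).2
      ⟨fun h0 => hc (by rw [h0, neg_zero, add_zero]), hk⟩)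

theorem exists_basicNhd_subset_preimage {n m : ℕ} (φ : IterLaurent A n →A[A] IterLaurent A m)
    (lam : Idx m) : ∃ mu : Idx n, ∀ f ∈ basicNhd (A := A) mu, φ f ∈ basicNhd (A := A) lam := by
  have h : Filter.Tendsto φ (nhds 0) (nhds 0) := by
    simpa using (map_continuous φ).tendsto (0 : IterLaurent A n)
  obtain ⟨_, ⟨mu, rfl⟩, hm⟩ := (((filterBasis A n).nhds_zero_hasBasis).tendsto_iff
    ((filterBasis A m).nhds_zero_hasBasis)).1 h _ ⟨lam, rfl⟩
  exact ⟨mu, hm⟩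

/-! ### Leading exponents of images -/

/-- Monomials are units, hence so are their images, and these have leading exponents modulo `p`;
additivity follows from uniqueness of the leading exponent. -/
theorem exists_isLead_map_monomial (p : PrimeSpectrum A) {n m : ℕ}
    (φ : IterLaurent A n →A[A] IterLaurent A m) :
    ∃ r : (Fin n → ℤ) →+ (Fin m → ℤ), ∀ l, IsLead p (φ (monomial A l)) (r l) := by
  choose r hr using fun l : Fin n → ℤ => exists_isLead_unit p
    (Units.map (φ : IterLaurent A n →* IterLaurent A m) (unitMonomial l))
  have hr' : ∀ l, IsLead p (φ (monomial A l)) (r l) := fun l => (hr l).1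
  refine ⟨AddMonoidHom.mk' r fun k l => (hr' _).unique ?_, hr'⟩
  rw [monomial_add, map_mul]
  exact (hr' k).mul (hr' l)

theorem IsLead.pow {p : PrimeSpectrum A} {n : ℕ} {f : IterLaurent A n} {l : Fin n → ℤ}
    (hf : IsLead p f l) (i : ℕ) : IsLead p (f ^ i) (i • l) := by
  induction i with
  | zero => rw [pow_zero, zero_smul]; exact isLead_one p n
  | succ i ih => rw [pow_succ, succ_nsmul]; exact ih.mul hf

theorem lexLT_neg {n : ℕ} {k l : Fin n → ℤ} (h : LexLT k l) : LexLT (-l) (-k) := by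
  have := lexLT_add (-k - l) h
  rwa [show k + (-k - l) = -l by abel, show l + (-k - l) = -k by abel] at this

theorem lexLT_trans {n : ℕ} {j k l : Fin n → ℤ} (h : LexLT j k) (h' : LexLT k l) :
    LexLT j l := by
  induction n with
  | zero => exact h.elim
  | succ n ih =>
    rcases h with h | ⟨h, g⟩ <;> rcases h' with h' | ⟨h', g'⟩
    · exact Or.inl (h.trans h')
    · exact Or.inl (h.trans_eq h')
    · exact Or.inl (h.trans_lt h')
    · exact Or.inr ⟨h.trans h', ih g g'⟩

theorem lexLT_irrefl {n : ℕ} (l : Fin n → ℤ) : ¬ LexLT l l := fun h => lexLT_asymm h h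

/-- The powers of `t^l` with `0 < l` come arbitrarily close to zero, hence so do the powers of its
image, whose leading exponent is therefore positive. -/
theorem lexLT_zero_of_isLead_map_monomial {p : PrimeSpectrum A} {n m : ℕ}
    (φ : IterLaurent A n →A[A] IterLaurent A m) {l : Fin n → ℤ} {r : Fin m → ℤ}
    (hl : LexLT 0 l) (hr : IsLead p (φ (monomial A l)) r) : LexLT 0 r := by
  by_contra h
  -- A single `U_λ` forces the coefficients at all `i • r` to vanish, although `i • r` is the
  -- leading exponent of the `i`-th power.
  obtain ⟨lam, hlam⟩ := exists_nsmul_mem_cone (l := -r) fun h' =>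
    h (by simpa using lexLT_neg h')
  obtain ⟨mu, hmu⟩ := exists_basicNhd_subset_preimage φ lam
  obtain ⟨i, hi⟩ := exists_nsmul_notMem_cone hl mu
  have h0 := hmu _ (monomial_mem_basicNhd hi) (i • r) (by rw [← smul_neg]; exact hlam i)
  rw [monomial_nsmul, map_pow] at h0
  refine (hr.pow i).2 ?_
  rw [h0]
  exact p.asIdeal.zero_mem

/-- Coefficients up to `r l` of `φ f` lie in `p` as soon as those of `f` up to `l` do. -/
theorem coeff_map_mem {p : PrimeSpectrum A} {n m : ℕ}
    (φ : IterLaurent A n →A[A] IterLaurent A m) {r : (Fin n → ℤ) →+ (Fin m → ℤ)}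
    (hr : ∀ l, IsLead p (φ (monomial A l)) (r l)) {f : IterLaurent A n} {l : Fin n → ℤ}
    (hf : ∀ k, ¬ LexLT l k → coeff f k ∈ p.asIdeal) {k : Fin m → ℤ} (hk : ¬ LexLT (r l) k) :
    coeff (φ f) k ∈ p.asIdeal := by
  -- Elements of this `U_λ` have zero coefficient at `k`, so approximating `f` closely enough
  -- determines that coefficient of `φ f` exactly.
  obtain ⟨lam, hlam⟩ := exists_mem_cone (-k)
  obtain ⟨mu, hmu⟩ := exists_basicNhd_subset_preimage φ lam
  obtain ⟨s, hs⟩ := exists_sub_sum_mem_basicNhd f mu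
  have h := hmu _ hs k hlam
  rw [map_sub, sub_eq_add_neg, coeff_add, coeff_neg, add_neg_eq_zero] at h
  rw [h, map_sum, coeff_sum]
  refine p.asIdeal.sum_mem fun j _ => ?_
  rw [map_smul, coeff_smul]
  by_cases hj : LexLT l j
  · refine p.asIdeal.mul_mem_left _ ((hr j).1 _ ?_)
    -- Strict monotonicity of `r` is positivity applied to the monomial `t^(j - l)`.
    have h1 : LexLT 0 (r (j - l)) := lexLT_zero_of_isLead_map_monomial φ
      (by simpa [sub_eq_add_neg] using lexLT_add (-l) hj) (hr _)
    have h2 : LexLT (r l) (r j) := by simpa using lexLT_add (r l) h1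
    rcases lexLT_trichotomy k (r l) with h3 | h3 | h3
    · exact lexLT_trans h3 h2
    · exact h3 ▸ h2
    · exact absurd h3 hk
  · exact p.asIdeal.mul_mem_right _ (hf j hj)

theorem IsLead.map {p : PrimeSpectrum A} {n m : ℕ}
    (φ : IterLaurent A n →A[A] IterLaurent A m) {r : (Fin n → ℤ) →+ (Fin m → ℤ)}
    (hr : ∀ l, IsLead p (φ (monomial A l)) (r l)) {f : IterLaurent A n} {l : Fin n → ℤ}
    (hf : IsLead p f l) : IsLead p (φ f) (r l) := by
  -- Modulo `p`, the remainder `g` lives strictly above `l`, so `φ g` cannot affect degrees up to `r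
  -- l`.
  set g := f - coeff f l • monomial A l with hg
  have hgc : ∀ k, ¬ LexLT l k → coeff g k ∈ p.asIdeal := fun k hk => by
    rw [hg, sub_eq_add_neg, coeff_add, coeff_neg, coeff_smul, coeff_monomial]
    split_ifs with h
    · rw [h, mul_one, add_neg_cancel]
      exact p.asIdeal.zero_mem
    · rw [mul_zero, neg_zero, add_zero]
      rcases lexLT_trichotomy k l with h' | h' | h'
      · exact hf.1 _ h'
      · exact absurd h' h
      · exact absurd h' hk
  have hfg : φ f = φ g + coeff f l • φ (monomial A l) := by
    rw [hg, map_sub, map_smul, sub_add_cancel]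
  rw [hfg]
  refine ⟨fun k hk => ?_, fun h => ?_⟩
  · rw [coeff_add, coeff_smul]
    exact p.asIdeal.add_mem (coeff_map_mem φ hr hgc (lexLT_asymm hk))
      (p.asIdeal.mul_mem_left _ ((hr l).1 k hk))
  · rw [coeff_add, p.asIdeal.add_mem_iff_right (coeff_map_mem φ hr hgc (lexLT_irrefl _)),
      coeff_smul] at h
    exact (p.isPrime.mem_or_mem h).elim hf.2 (hr l).2

/-! ### Valuations of images and multiplicativity of `Υ`. -/

theorem val_eq_of_isLead {n : ℕ} {f : (IterLaurent A n)ˣ}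
    {v : Fin n → LocallyConstant (PrimeSpectrum A) ℤ}
    (h : ∀ p, IsLead p (f : IterLaurent A n) (fun j => v j p)) : val f = v :=
  (existsUnique_isVal f).unique (isVal_val f) ((isVal_iff_isLead _ _).2 h)

theorem isLead_val {n : ℕ} (f : (IterLaurent A n)ˣ) (p : PrimeSpectrum A) :
    IsLead p (f : IterLaurent A n) (fun j => val f j p) :=
  (isVal_iff_isLead _ _).1 (isVal_val f) p

theorem val_map {n m : ℕ} (φ : IterLaurent A n →A[A] IterLaurent A m) (f : (IterLaurent A n)ˣ) :
    val (Units.map (φ : IterLaurent A n →* IterLaurent A m) f) =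
      (upsilon φ).mulVec (val f) := by
  refine val_eq_of_isLead fun p => ?_
  obtain ⟨r, hr⟩ := exists_isLead_map_monomial p φ
  have h : r (fun j => val f j p) = fun i => (upsilon φ).mulVec (val f) i p := by
    -- Since `t_j` is the monomial of the `j`-th basis vector, the columns of `Υ(φ)` at `p` are the
    -- values of `r` on the standard basis.
    have hu : ∀ j, r (Pi.single j 1) = fun i => upsilon φ i j p := fun j => by
      refine (hr _).unique ?_
      rw [← var_eq_monomial]
      exact isLead_val (Units.map (φ : IterLaurent A n →* IterLaurent A m) (var j)) p
    have hsum : (fun j => val f j p) = ∑ j, val f j p • (Pi.single j 1 : Fin n → ℤ) :=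
      pi_eq_sum_univ' _
    rw [hsum, map_sum]
    ext i
    have he : (upsilon φ).mulVec (val f) i p = ∑ j, upsilon φ i j p * val f j p := by
      rw [Matrix.mulVec, dotProduct]
      exact map_sum (LocallyConstant.evalAddMonoidHom p) _ _
    simp only [map_zsmul, hu, Finset.sum_apply, Pi.smul_apply, smul_eq_mul, he, mul_comm]
  rw [← h]
  exact (isLead_val f p).map φ hr

theorem upsilon_one (n : ℕ) : upsilon (1 : IterLaurent A n →A[A] IterLaurent A n) = 1 := by
  ext i j p
  have h : val (var j : (IterLaurent A n)ˣ) = fun i => (1 : Matrix (Fin n) (Fin n) _) i j := by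
    refine val_eq_of_isLead fun p => ?_
    rw [var_eq_monomial]
    convert isLead_monomial p (Pi.single j 1 : Fin n → ℤ) using 2 with i
    rw [Matrix.one_apply, Pi.single_apply]
    split_ifs <;> rfl
  exact DFunLike.congr_fun (congrFun h i) p

/-- Column `j` is `val_map` for `φ` and the unit `ψ(t_j)`, whose valuation is column `j` of `Υ(ψ)`.
-/
theorem upsilon_mul {n : ℕ} (φ ψ : IterLaurent A n →A[A] IterLaurent A n) :
    upsilon (φ * ψ) = upsilon φ * upsilon ψ := by
  ext1 i j
  exact congrFun (val_map φ (Units.map (ψ : IterLaurent A n →* IterLaurent A n) (var j))) i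

/-- The map `Υ` as a homomorphism of monoids. -/
def upsilonHom (n : ℕ) : (IterLaurent A n →A[A] IterLaurent A n) →*
    Matrix (Fin n) (Fin n) (LocallyConstant (PrimeSpectrum A) ℤ) where
  toFun := upsilon
  map_one' := upsilon_one n
  map_mul' := upsilon_mul

end IterLaurent

end

theorem mainTheorem8 {A : Type u} [CommRing A] :
    (∀ (n m : ℕ) (φ : IterLaurent A n →A[A] IterLaurent A m) (f : (IterLaurent A n)ˣ),
      IterLaurent.val (Units.map (φ : IterLaurent A n →* IterLaurent A m) f) =
        (IterLaurent.upsilon φ).mulVec (IterLaurent.val f)) ∧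
    ∀ n : ℕ,
      IterLaurent.upsilon (1 : IterLaurent A n →A[A] IterLaurent A n) = 1 ∧
      (∀ φ ψ : IterLaurent A n →A[A] IterLaurent A n,
        IterLaurent.upsilon (φ * ψ) = IterLaurent.upsilon φ * IterLaurent.upsilon ψ) ∧
      ∀ φ : IterLaurent A n →A[A] IterLaurent A n,
        IsUnit φ → IsUnit (IterLaurent.upsilon φ) :=
  ⟨fun _ _ => IterLaurent.val_map, fun n => ⟨IterLaurent.upsilon_one n, IterLaurent.upsilon_mul,
    fun _ h => h.map (IterLaurent.upsilonHom n)⟩⟩
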